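/- Let $\mathbb{K}$ be the digital line, i.e. $\mathbb{Z}$ with the Khalimsky topology generated by the sets $\{n\}$ for $n$ odd and $\{n-1,n,n+1\}$ for $n$ even, and let $\mathbb{K}^2$ carry the product topology. For $x\in\mathbb{K}^2$ let $N(x)$ be the smallest open set containing $x$, let $cl(x)$ be the closure of $\{x\}$, and let $A(x)=\{y\neq x : \{x,y\}\text{ is connected}\}$ be the set of points adjacent to $x$. A point of $\mathbb{K}^2$ is pure if its coordinates have the same parity, and mixed otherwise. An arc is a subset homeomorphic (in the subspace topology) to a finite interval of $\mathbb{K}$; a Jordan curve is a connected set $J$ with $|J|\ge 4$ such that $J\setminus\{x\}$ is an arc for every $x\in J$. Let $\Gamma:\mathbb{Z}^2\to\mathbb{K}^2$, $\Gamma(x,y)=(x+y,y-x)$, and for $A\subseteq\mathbb{Z}^2$ and $J\subseteq\mathbb{K}^2$ put $$\Gamma^*(A)=\Gamma(A)\cup\{x \text{ mixed} : N(x)\subseteq\Gamma(A)\cup\{x\}\ \text{or}\ cl(x)\subseteq\Gamma(A)\cup\{x\}\},$$ $$A_J=\{x\text{ mixed} : A(x)\subseteq\Gamma(A)\cup J\}.$$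 Two points of $\mathbb{Z}^2$ are 4-adjacent if they differ by $(\pm1,0)$ or $(0,\pm1)$; a subset of $\mathbb{Z}^2$ is 4-connected if it cannot be divided into two nonempty subsets with no point of one 4-adjacent to a point of the other; the 4-components of a set are its maximal 4-connected subsets. Theorem. Let $J$ be a Jordan curve in $\mathbb{K}^2$ with more than four points such that $\Gamma^*(\Gamma^{-1}(J))=J$. Then $\mathbb{K}^2\setminus J$ has exactly two connected components, and every point of $J$ is adjacent to some point of each of them. Moreover, $\mathbb{Z}^2\setminus\Gamma^{-1}(J)$ has exactly two 4-components $A$ and $B$, and the connected components of $\mathbb{K}^2\setminus J$ are $\Gamma^*(A)\cup A_J$ and $\Gamma^*(B)\cup B_J$. -/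

import Mathlib

/-- The underlying set of the digital line: a copy of `ℤ` that does not carry the discrete
topology of `ℤ`. -/
def DigitalLine : Type := ℤ

namespace DigitalLine

/-- The identity, regarded as a map between the integers and the points of the digital line. -/
def ofInt : ℤ ≃ DigitalLine := Equiv.refl ℤ

/-- The integer underlying a point of the digital line. -/
def toInt (n : DigitalLine) : ℤ := ofInt.symm n

/-- The generating sets: `{n}` for `n` odd, `{n - 1, n, n + 1}` for `n` even. -/
def basicNhd (n : ℤ) : Set ℤ := if Odd n then {n} else {n - 1, n, n + 1}

/-- The Khalimsky topology. -/
instance instTopologicalSpace : TopologicalSpace DigitalLine :=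
  TopologicalSpace.generateFrom (Set.range fun n : ℤ => ofInt '' basicNhd n)

/-- The finite interval of the digital line with end points `a` and `b`. -/
def interval (a b : ℤ) : Set DigitalLine := ofInt '' Set.Icc a b

end DigitalLine

/-- The digital plane, with the product of the Khalimsky topologies. -/
abbrev DigitalPlane : Type := DigitalLine × DigitalLine

namespace DigitalTopology

section General

variable {X : Type*} [TopologicalSpace X]

/-- The adjacency `A(x)` of a point `x`. -/
def adjacency (x : X) : Set X := {y | y ≠ x ∧ IsConnected ({x, y} : Set X)}

/-- An arc: a subset that is homeomorphic, in the subspace topology, to a nonempty finite interval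
of the digital line. -/
def IsArc (C : Set X) : Prop :=
  ∃ a b : ℤ, a ≤ b ∧ Nonempty (DigitalLine.interval a b ≃ₜ C)

/-- A Jordan curve. -/
def IsJordanCurve (J : Set X) : Prop :=
  IsConnected J ∧ 4 ≤ J.encard ∧ ∀ x ∈ J, IsArc (J \ {x})

/-- The set of connected components of a subset `S`. -/
def components (S : Set X) : Set (Set X) := connectedComponentIn S '' S

end General

/-- A point of the digital plane is pure if its coordinates are both even or both odd. -/
def IsPure (p : DigitalPlane) : Prop :=
  (Even p.1.toInt ∧ Even p.2.toInt) ∨ (Odd p.1.toInt ∧ Odd p.2.toInt)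

/-- A point of the digital plane is mixed if it is not pure. -/
def IsMixed (p : DigitalPlane) : Prop := ¬ IsPure p

/-- The slant map `Γ(x, y) = (x + y, y - x)`. -/
def slant (p : ℤ × ℤ) : DigitalPlane :=
  (DigitalLine.ofInt (p.1 + p.2), DigitalLine.ofInt (p.2 - p.1))

/-- The operator `Γ*`. In the digital plane, `nhdsKer {x}` (the intersection of all neighbourhoods
of `x`) is the smallest open set `N(x)` containing `x`. -/
def slantStar (A : Set (ℤ × ℤ)) : Set DigitalPlane :=
  slant '' A ∪
    {x | IsMixed x ∧ (nhdsKer {x} ⊆ slant '' A ∪ {x} ∨ closure {x} ⊆ slant '' A ∪ {x})}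

/-- The set `A_J` of the mixed points `x` with `A(x) ⊆ Γ(A) ∪ J`. -/
def mixedFill (A : Set (ℤ × ℤ)) (J : Set DigitalPlane) : Set DigitalPlane :=
  {x | IsMixed x ∧ adjacency x ⊆ slant '' A ∪ J}

/-- `q` is one of the four points of `ℤ²` that are 4-adjacent to `p`. -/
def FourAdj (p q : ℤ × ℤ) : Prop :=
  q = (p.1 + 1, p.2) ∨ q = (p.1 - 1, p.2) ∨ q = (p.1, p.2 + 1) ∨ q = (p.1, p.2 - 1)

/-- `S` is 4-connected if it is not the union of two disjoint nonempty sets that are not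
4-adjacent to each other. -/
def FourConnected (S : Set (ℤ × ℤ)) : Prop :=
  ¬ ∃ A B : Set (ℤ × ℤ), A.Nonempty ∧ B.Nonempty ∧ Disjoint A B ∧ A ∪ B = S ∧
    ∀ p ∈ A, ∀ q ∈ B, ¬ FourAdj p q

/-- The set of 4-components of `S`, that is, of maximal 4-connected subsets of `S`. -/
def fourComponents (S : Set (ℤ × ℤ)) : Set (Set (ℤ × ℤ)) :=
  {C | Maximal (fun T => T ⊆ S ∧ FourConnected T) C}

end DigitalTopology

open Set DigitalTopology

/-!
A finite interval of the digital line has no triangles and no branching in its adjacency graph, so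
every point of a Jordan curve `J` has exactly two neighbours in `J`, and these are not adjacent to
each other. In the digital plane the neighbours of a point form a cycle, its link; hence `J` cuts
the link of each of its points into two paths, and passing from one point of `J` to the next shows
that `Jᶜ` has at most two components.

Colour a point off `J` by the parity of the number of edges of `J` that cross a ray issuing from it.
All degrees of `J` are even, so the colour is constant on the components of `Jᶜ`, while the two
common neighbours of adjacent points of `J` get different colours. Hence there are two components,
and every point of `J` is adjacent to both.

The four neighbours of a mixed point are pure: two lie in `N(x)`, the other two in `cl(x)`, and each
of the former is adjacent to each of the latter. The condition `Γ*(Γ⁻¹(J)) = J` says that a mixed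
point off `J` has a neighbour off `J` of either kind, so that every detour through it can be
replaced by a path of pure points off `J`, that is, by a 4-connected path.
-/

namespace DigitalTopology

section Adjacency

variable {X : Type*} [TopologicalSpace X]

theorem mem_adjacency_iff {x y : X} : y ∈ adjacency x ↔ y ≠ x ∧ (x ⤳ y ∨ y ⤳ x) := by
  refine and_congr_right fun _ => ⟨fun h => ?_, fun h => ⟨⟨x, by simp⟩, ?_⟩⟩
  · by_contra! hcon
    simp only [specializes_iff_forall_open] at hcon
    push Not at hcon
    obtain ⟨⟨U, hU, hyU, hxU⟩, V, hV, hxV, hyV⟩ := hcon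
    obtain ⟨z, rfl | rfl, hzU, hzV⟩ := h.isPreconnected U V hU hV
      (by rintro z (rfl | rfl) <;> simp [*]) ⟨y, by simp, hyU⟩ ⟨x, by simp, hxV⟩
    exacts [hxU hzU, hyV hzV]
  · rcases h with h | h
    · exact isPreconnected_singleton.subset_closure (s := {x}) (by simp)
        (pair_subset (subset_closure rfl) (specializes_iff_mem_closure.1 h))
    · exact isPreconnected_singleton.subset_closure (s := {y}) (by simp)
        (pair_subset (specializes_iff_mem_closure.1 h) (subset_closure rfl))

theorem mem_adjacency_comm {x y : X} : y ∈ adjacency x ↔ x ∈ adjacency y := by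
  rw [mem_adjacency_iff, mem_adjacency_iff, ne_comm, or_comm]

theorem mem_adjacency_map_iff {Y : Type*} [TopologicalSpace Y] {f : X → Y}
    (hf : Topology.IsEmbedding f) {x y : X} :
    f y ∈ adjacency (f x) ↔ y ∈ adjacency x := by
  simp only [mem_adjacency_iff, hf.injective.ne_iff, hf.isInducing.specializes_iff]

theorem isPreconnected_induction [AlexandrovDiscrete X] {S : Set X} (hS : IsPreconnected S)
    {Q : X → Prop} (step : ∀ x ∈ S, ∀ y ∈ S, y ∈ adjacency x → Q x → Q y)
    {x y : X} (hx : x ∈ S) (hy : y ∈ S) (hQx : Q x) : Q y := by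
  by_contra hQy
  have iff_of_specializes : ∀ u ∈ S, ∀ v ∈ S, u ⤳ v → (Q u ↔ Q v) := by
    intro u hu v hv h
    obtain rfl | hne := eq_or_ne u v
    · rfl
    · exact ⟨step u hu v hv (mem_adjacency_iff.2 ⟨hne.symm, .inl h⟩),
        step v hv u hu (mem_adjacency_iff.2 ⟨hne, .inr h⟩)⟩
  obtain ⟨z, hz, hzQ, hznQ⟩ := hS (nhdsKer {u | u ∈ S ∧ Q u}) (nhdsKer {u | u ∈ S ∧ ¬ Q u})
    isOpen_nhdsKer isOpen_nhdsKer
    (fun u hu => (em (Q u)).imp (fun h => subset_nhdsKer ⟨hu, h⟩) fun h => subset_nhdsKer ⟨hu, h⟩)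
    ⟨x, hx, subset_nhdsKer ⟨hx, hQx⟩⟩ ⟨y, hy, subset_nhdsKer ⟨hy, hQy⟩⟩
  obtain ⟨u, ⟨hu, hQu⟩, huz⟩ := mem_nhdsKer_iff_specializes.1 hzQ
  obtain ⟨v, ⟨hv, hQv⟩, hvz⟩ := mem_nhdsKer_iff_specializes.1 hznQ
  exact hQv ((iff_of_specializes z hz v hv hvz).1 ((iff_of_specializes z hz u hu huz).2 hQu))

theorem isPreconnected_of_adjacency_induction {S : Set X}
    (h : ∀ Q : X → Prop, (∀ x ∈ S, ∀ y ∈ S, y ∈ adjacency x → Q x → Q y) →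
      ∀ x ∈ S, ∀ y ∈ S, Q x → Q y) : IsPreconnected S := by
  intro U V hU hV hS ⟨x, hx, hxU⟩ ⟨y, hy, hyV⟩
  by_contra hcon
  have disjoint : ∀ z ∈ S, z ∈ U → z ∉ V := fun z hz h1 h2 => hcon ⟨z, hz, h1, h2⟩
  refine disjoint y hy (h (· ∈ U) (fun u hu v hv huv huU => ?_) x hx y hy hxU) hyV
  rcases (mem_adjacency_iff.1 huv).2 with h | h
  · exact (hS hv).resolve_right fun hvV => disjoint u hu huU (h.mem_open hV hvV)
  · exact h.mem_open hU huU

theorem connectedComponentIn_eq_of_mem_adjacency {S : Set X} {x y : X} (hx : x ∈ S) (hy : y ∈ S)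
    (h : y ∈ adjacency x) : connectedComponentIn S x = connectedComponentIn S y :=
  connectedComponentIn_eq
    (h.2.isPreconnected.subset_connectedComponentIn (by simp) (pair_subset hx hy) (by simp))

theorem exists_adjacent_connectedComponentIn_eq [AlexandrovDiscrete X] [PreconnectedSpace X]
    {J : Set X} (hJ : J.Nonempty) {p : X} (hp : p ∉ J) :
    ∃ x ∈ J, ∃ q ∈ adjacency x \ J, connectedComponentIn Jᶜ q = connectedComponentIn Jᶜ p := by
  obtain ⟨x₀, hx₀⟩ := hJ
  refine isPreconnected_induction (Q := fun p => p ∉ J → ∃ x ∈ J, ∃ q ∈ adjacency x \ J,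
      connectedComponentIn Jᶜ q = connectedComponentIn Jᶜ p)
    isPreconnected_univ (fun u _ v _ huv hu hv => ?_) (mem_univ x₀) (mem_univ p)
    (absurd hx₀) hp
  by_cases huJ : u ∈ J
  · exact ⟨u, huJ, v, ⟨huv, hv⟩, rfl⟩
  · rw [← connectedComponentIn_eq_of_mem_adjacency huJ hv huv]
    exact hu huJ

theorem subset_of_mem_components {S D : Set X} (hD : D ∈ components S) : D ⊆ S := by
  obtain ⟨x, -, rfl⟩ := hD
  exact connectedComponentIn_subset S x

theorem eq_connectedComponentIn_of_mem {S D : Set X} (hD : D ∈ components S) {x : X}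
    (hx : x ∈ D) : D = connectedComponentIn S x := by
  obtain ⟨y, -, rfl⟩ := hD
  exact connectedComponentIn_eq hx

theorem mem_of_mem_adjacency_of_mem_components {S D : Set X} (hD : D ∈ components S) {x y : X}
    (hx : x ∈ D) (hy : y ∈ S) (h : y ∈ adjacency x) : y ∈ D := by
  rw [eq_connectedComponentIn_of_mem hD hx,
    connectedComponentIn_eq_of_mem_adjacency (subset_of_mem_components hD hx) hy h]
  exact mem_connectedComponentIn hy

theorem mem_adjacency_of_specializes_of_specializes [T0Space X] {x y z : X} (hy : y ⤳ x)
    (hyx : y ≠ x) (hz : x ⤳ z) : z ∈ adjacency y :=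
  mem_adjacency_iff.2 ⟨fun h => hyx (hy.antisymm (h ▸ hz)).eq, .inl (hy.trans hz)⟩

end Adjacency

end DigitalTopology

namespace DigitalLine

theorem mem_basicNhd {a b : ℤ} : b ∈ basicNhd a ↔ b = a ∨ (Even a ∧ (b = a - 1 ∨ b = a + 1)) := by
  unfold basicNhd
  split_ifs with h
  · simp [Int.not_even_iff_odd.2 h]
  · simp [Int.not_odd_iff_even.1 h, or_left_comm]

theorem isOpen_basicNhd (a : ℤ) : IsOpen (ofInt '' basicNhd a) :=
  TopologicalSpace.isOpen_generateFrom_of_mem ⟨a, rfl⟩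

theorem ofInt_specializes_ofInt {a b : ℤ} : ofInt b ⤳ ofInt a ↔ b ∈ basicNhd a := by
  constructor
  · intro h
    simpa using h.mem_open (isOpen_basicNhd a) ⟨a, mem_basicNhd.2 (.inl rfl), rfl⟩
  · intro h
    rw [specializes_iff_forall_open]
    intro s hs
    induction hs with
    | basic s hs =>
      obtain ⟨n, rfl⟩ := hs
      simp only [ofInt.injective.mem_set_image, mem_basicNhd, Int.even_iff] at h ⊢
      omega
    | univ => simp
    | inter s t _ _ ihs iht => exact fun h => ⟨ihs h.1, iht h.2⟩
    | sUnion S _ ih => exact fun ⟨s, hs, h⟩ => ⟨s, hs, ih s hs h⟩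

instance instT0Space : T0Space DigitalLine := by
  refine ⟨fun x y h => ?_⟩
  obtain ⟨a, rfl⟩ := ofInt.surjective x
  obtain ⟨b, rfl⟩ := ofInt.surjective y
  have hab := ofInt_specializes_ofInt.1 h.specializes
  have hba := ofInt_specializes_ofInt.1 h.specializes'
  rw [mem_basicNhd, Int.even_iff] at hab hba
  rw [ofInt.apply_eq_iff_eq]
  omega

instance instAlexandrovDiscrete : AlexandrovDiscrete DigitalLine := by
  refine ⟨fun S hS => isOpen_iff_mem_nhds.2 fun x hx => ?_⟩
  obtain ⟨a, rfl⟩ := ofInt.surjective x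
  refine Filter.mem_of_superset
    ((isOpen_basicNhd a).mem_nhds ⟨a, mem_basicNhd.2 (.inl rfl), rfl⟩) ?_
  rintro _ ⟨b, hb, rfl⟩ s hs
  exact (ofInt_specializes_ofInt.2 hb).mem_open (hS s hs) (hx s hs)

theorem ofInt_mem_adjacency_ofInt {a b : ℤ} :
    ofInt b ∈ adjacency (ofInt a) ↔ b = a + 1 ∨ a = b + 1 := by
  simp only [mem_adjacency_iff, ofInt_specializes_ofInt, mem_basicNhd, ofInt.injective.ne_iff,
    Int.even_iff]
  omega

instance instPreconnectedSpace : PreconnectedSpace DigitalLine := by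
  refine ⟨isPreconnected_of_adjacency_induction fun Q step x _ y _ hQx => ?_⟩
  obtain ⟨a, rfl⟩ := ofInt.surjective x
  obtain ⟨b, rfl⟩ := ofInt.surjective y
  have step' : ∀ m n : ℤ, n = m + 1 ∨ m = n + 1 → Q (ofInt m) → Q (ofInt n) := fun m n h =>
    step _ (mem_univ _) _ (mem_univ _) (ofInt_mem_adjacency_ofInt.2 h)
  exact Int.inductionOn' b a hQx (fun k _ => step' k (k + 1) (.inl rfl))
    fun k _ => step' k (k - 1) (.inr (by omega))

end DigitalLine

namespace DigitalTopology

section JordanCurve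

variable {X : Type*} [TopologicalSpace X] {C J : Set X} {x u v w : X}

theorem IsArc.exists_parametrization (hC : IsArc C) :
    ∃ (a b : ℤ) (φ : Icc a b → X), φ.Injective ∧ range φ = C ∧
      ∀ s t, φ t ∈ adjacency (φ s) ↔ (t : ℤ) = s + 1 ∨ (s : ℤ) = t + 1 := by
  obtain ⟨a, b, -, ⟨e⟩⟩ := hC
  let i : Icc a b ≃ DigitalLine.interval a b := DigitalLine.ofInt.image (Icc a b)
  refine ⟨a, b, fun t => e (i t), (Subtype.val_injective.comp e.injective).comp i.injective, ?_,
    fun s t => ?_⟩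
  · rw [show (fun t => (e (i t) : X)) = Subtype.val ∘ (e ∘ i) from rfl, range_comp,
      (e.surjective.comp i.surjective).range_eq, image_univ, Subtype.range_coe]
  · rw [mem_adjacency_map_iff Topology.IsEmbedding.subtypeVal, mem_adjacency_map_iff e.isEmbedding,
      ← mem_adjacency_map_iff Topology.IsEmbedding.subtypeVal,
      ← DigitalLine.ofInt_mem_adjacency_ofInt]
    rfl

theorem IsArc.finite (hC : IsArc C) : C.Finite := by
  obtain ⟨a, b, φ, -, rfl, -⟩ := hC.exists_parametrization
  exact finite_range φ

theorem IsArc.exists_mem_adjacency (hC : IsArc C) (hx : x ∈ C) (hu : u ∈ C) (hne : u ≠ x) :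
    ∃ v ∈ C, v ∈ adjacency x := by
  obtain ⟨a, b, φ, -, rfl, hadj⟩ := hC.exists_parametrization
  obtain ⟨⟨s, hs⟩, rfl⟩ := hx
  obtain ⟨⟨t, ht⟩, rfl⟩ := hu
  have hst : t ≠ s := by rintro rfl; exact hne rfl
  rw [mem_Icc] at hs ht
  rcases lt_or_gt_of_ne hst with hlt | hlt
  · exact ⟨φ ⟨s - 1, by grind⟩, mem_range_self _, (hadj _ _).2 (.inr (by grind))⟩
  · exact ⟨φ ⟨s + 1, by grind⟩, mem_range_self _, (hadj _ _).2 (.inl rfl)⟩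

theorem IsArc.not_triangle (hC : IsArc C) (hx : x ∈ C) (hu : u ∈ C) (hv : v ∈ C)
    (hxu : u ∈ adjacency x) (hxv : v ∈ adjacency x) : v ∉ adjacency u := by
  obtain ⟨a, b, φ, -, rfl, hadj⟩ := hC.exists_parametrization
  obtain ⟨s, rfl⟩ := hx
  obtain ⟨t, rfl⟩ := hu
  obtain ⟨r, rfl⟩ := hv
  rw [hadj] at *
  omega

theorem IsArc.not_three_neighbours (hC : IsArc C) (hx : x ∈ C) (hu : u ∈ C) (hv : v ∈ C)
    (hw : w ∈ C) (hxu : u ∈ adjacency x) (hxv : v ∈ adjacency x) (hxw : w ∈ adjacency x) :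
    u = v ∨ u = w ∨ v = w := by
  obtain ⟨a, b, φ, hφ, rfl, hadj⟩ := hC.exists_parametrization
  obtain ⟨s, rfl⟩ := hx
  obtain ⟨t, rfl⟩ := hu
  obtain ⟨r, rfl⟩ := hv
  obtain ⟨q, rfl⟩ := hw
  simp only [hadj, hφ.eq_iff, Subtype.ext_iff] at *
  omega

theorem IsJordanCurve.exists_mem_ne (hJ : IsJordanCurve J) (x u v : X) :
    ∃ z ∈ J, z ≠ x ∧ z ≠ u ∧ z ≠ v := by
  by_contra! hcon
  have hsub : J ⊆ {x, u, v} := fun z hz => by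
    by_contra hz'
    grind
  have hle : ({x, u, v} : Set X).encard ≤ 3 :=
    calc ({x, u, v} : Set X).encard ≤ ({u, v} : Set X).encard + 1 := encard_insert_le _ _
      _ ≤ ({v} : Set X).encard + 1 + 1 := by gcongr; exact encard_insert_le _ _
      _ = 3 := by rw [encard_singleton]; rfl
  exact absurd (hJ.2.1.trans ((encard_le_encard hsub).trans hle)) (by decide)

theorem IsJordanCurve.finite (hJ : IsJordanCurve J) : J.Finite := by
  obtain ⟨x, hx⟩ := hJ.1.nonempty
  exact ((hJ.2.2 x hx).finite.union (finite_singleton x)).subset (by simp)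

theorem IsJordanCurve.not_triangle (hJ : IsJordanCurve J) (hx : x ∈ J) (hu : u ∈ J) (hv : v ∈ J)
    (hxu : u ∈ adjacency x) (hxv : v ∈ adjacency x) : v ∉ adjacency u := by
  obtain ⟨z, hz, hzx, hzu, hzv⟩ := hJ.exists_mem_ne x u v
  exact (hJ.2.2 z hz).not_triangle ⟨hx, hzx.symm⟩ ⟨hu, hzu.symm⟩ ⟨hv, hzv.symm⟩ hxu hxv

theorem IsJordanCurve.exists_mem_adjacency_ne (hJ : IsJordanCurve J) (hx : x ∈ J) (hu : u ∈ J)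
    (hne : u ≠ x) : ∃ v ∈ J, v ∈ adjacency x ∧ v ≠ u := by
  obtain ⟨z, hz, hzx, hzu, -⟩ := hJ.exists_mem_ne x u u
  obtain ⟨v, hv, hxv⟩ := (hJ.2.2 u hu).exists_mem_adjacency ⟨hx, hne.symm⟩ ⟨hz, hzu⟩ hzx
  exact ⟨v, hv.1, hxv, hv.2⟩

theorem IsJordanCurve.exists_mem_adjacency (hJ : IsJordanCurve J) (hx : x ∈ J) :
    ∃ y ∈ J, y ∈ adjacency x := by
  obtain ⟨z, hz, hzx, -⟩ := hJ.exists_mem_ne x x x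
  obtain ⟨y, hy, hxy, -⟩ := hJ.exists_mem_adjacency_ne hx hz hzx
  exact ⟨y, hy, hxy⟩

theorem IsJordanCurve.not_three_neighbours (hJ : IsJordanCurve J) (hx : x ∈ J) (hu : u ∈ J)
    (hv : v ∈ J) (hw : w ∈ J) (hxu : u ∈ adjacency x) (hxv : v ∈ adjacency x)
    (hxw : w ∈ adjacency x) : u = v ∨ u = w ∨ v = w := by
  by_contra! hne
  -- A further neighbour `z` of `u` misses the star formed by `x`, `u`, `v`, `w`.
  obtain ⟨z, hz, huz, hzx⟩ := hJ.exists_mem_adjacency_ne hu hx hxu.1.symm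
  have ne_of_adjacent : ∀ y ∈ J, y ∈ adjacency x → y ≠ z := by
    rintro y hy hxy rfl
    exact hJ.not_triangle hx hu hy hxu hxy huz
  have := (hJ.2.2 z hz).not_three_neighbours ⟨hx, hzx.symm⟩ ⟨hu, ne_of_adjacent u hu hxu⟩
    ⟨hv, ne_of_adjacent v hv hxv⟩ ⟨hw, ne_of_adjacent w hw hxw⟩ hxu hxv hxw
  tauto

theorem IsJordanCurve.encard_adjacency_inter (hJ : IsJordanCurve J) (hx : x ∈ J) :
    (adjacency x ∩ J).encard = 2 := by
  obtain ⟨u, hu, hxu⟩ := hJ.exists_mem_adjacency hx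
  obtain ⟨v, hv, hxv, hvu⟩ := hJ.exists_mem_adjacency_ne hx hu hxu.1
  refine encard_eq_two.2 ⟨u, v, hvu.symm, Subset.antisymm (fun w hw => ?_)
    (pair_subset ⟨hxu, hu⟩ ⟨hxv, hv⟩)⟩
  have := hJ.not_three_neighbours hx hu hv hw.2 hxu hxv hw.1
  grind

end JordanCurve

section Plane

/-- The point of the digital plane with the given integer coordinates. -/
def point (a b : ℤ) : DigitalPlane := (DigitalLine.ofInt a, DigitalLine.ofInt b)

theorem exists_eq_point (x : DigitalPlane) : ∃ a b, x = point a b := ⟨x.1.toInt, x.2.toInt, rfl⟩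

theorem point_inj {a b c d : ℤ} : point a b = point c d ↔ a = c ∧ b = d := by
  simp [point]

theorem point_specializes_point {a b c d : ℤ} :
    point a b ⤳ point c d ↔
      (a = c ∨ (c % 2 = 0 ∧ (a = c - 1 ∨ a = c + 1))) ∧
      (b = d ∨ (d % 2 = 0 ∧ (b = d - 1 ∨ b = d + 1))) := by
  simp only [point, specializes_prod, DigitalLine.ofInt_specializes_ofInt,
    DigitalLine.mem_basicNhd, Int.even_iff]

theorem point_mem_adjacency {a b c d : ℤ} :
    point c d ∈ adjacency (point a b) ↔
      (c ≠ a ∨ d ≠ b) ∧ (a - 1 ≤ c ∧ c ≤ a + 1) ∧ (b - 1 ≤ d ∧ d ≤ b + 1) ∧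
        (c = a ∨ d = b ∨ (a + b) % 2 = 0) := by
  simp only [mem_adjacency_iff, point_specializes_point, ne_eq, point_inj]
  omega

theorem adjacency_induction {P : DigitalPlane → DigitalPlane → Prop}
    (symm : ∀ x y, P x y → P y x)
    (horizontal : ∀ a b, P (point a b) (point (a + 1) b))
    (vertical : ∀ a b, P (point a b) (point a (b + 1)))
    (diagonal : ∀ a b, (a + b) % 2 = 0 → P (point a b) (point (a + 1) (b + 1)))
    (antidiagonal : ∀ a b, (a + b) % 2 = 1 → P (point (a + 1) b) (point a (b + 1)))
    {x y : DigitalPlane} (h : y ∈ adjacency x) : P x y := by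
  obtain ⟨a, b, rfl⟩ := exists_eq_point x
  obtain ⟨c, d, rfl⟩ := exists_eq_point y
  rw [point_mem_adjacency] at h
  have hcases : (c = a + 1 ∧ d = b) ∨ (a = c + 1 ∧ d = b) ∨ (c = a ∧ d = b + 1) ∨
      (c = a ∧ b = d + 1) ∨ (c = a + 1 ∧ d = b + 1) ∨ (a = c + 1 ∧ b = d + 1) ∨
      (a = c + 1 ∧ d = b + 1) ∨ (c = a + 1 ∧ b = d + 1) := by omega
  rcases hcases with ⟨rfl, rfl⟩ | ⟨rfl, rfl⟩ | ⟨rfl, rfl⟩ | ⟨rfl, rfl⟩ | ⟨rfl, rfl⟩ | ⟨rfl, rfl⟩ |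
    ⟨rfl, rfl⟩ | ⟨rfl, rfl⟩
  · exact horizontal _ _
  · exact symm _ _ (horizontal _ _)
  · exact vertical _ _
  · exact symm _ _ (vertical _ _)
  · exact diagonal _ _ (by omega)
  · exact symm _ _ (diagonal _ _ (by omega))
  · exact antidiagonal _ _ (by omega)
  · exact symm _ _ (antidiagonal _ _ (by omega))

end Plane

section Link

variable {X : Type*} [TopologicalSpace X]

/-- The link of a point `x`, that is, its set of adjacent points, is the cycle `r`. -/
structure IsLink (x : X) {n : ℕ} (r : ZMod n → X) : Prop where
  injective : r.Injective
  range_eq : range r = adjacency x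
  succ_mem_adjacency : ∀ i, r (i + 1) ∈ adjacency (r i)

theorem exists_isLink_of_pure {a b : ℤ} (h : (a + b) % 2 = 0) :
    ∃ r : ZMod 8 → DigitalPlane, IsLink (point a b) r := by
  obtain ⟨dx, dy, inj, bounds, surj, succ⟩ : ∃ dx dy : Fin 8 → ℤ,
      (∀ i j, dx i = dx j → dy i = dy j → i = j) ∧
      (∀ i, (-1 ≤ dx i ∧ dx i ≤ 1) ∧ (-1 ≤ dy i ∧ dy i ≤ 1) ∧ (dx i ≠ 0 ∨ dy i ≠ 0)) ∧
      (∀ s ∈ Finset.Icc (-1) 1, ∀ t ∈ Finset.Icc (-1) 1, s ≠ 0 ∨ t ≠ 0 →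
        ∃ i, dx i = s ∧ dy i = t) ∧
      ∀ i, (dx (i + 1) = dx i ∧ (dy (i + 1) = dy i + 1 ∨ dy i = dy (i + 1) + 1)) ∨
        (dy (i + 1) = dy i ∧ (dx (i + 1) = dx i + 1 ∨ dx i = dx (i + 1) + 1)) :=
    ⟨![1, 1, 0, -1, -1, -1, 0, 1], ![0, 1, 1, 1, 0, -1, -1, -1], by decide⟩
  refine ⟨fun i => point (a + dx i) (b + dy i), fun i j hij => ?_,
    Subset.antisymm ?_ fun x hx => ?_, fun i => ?_⟩
  · have hij := point_inj.1 hij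
    exact inj i j (by omega) (by omega)
  · rintro _ ⟨i, rfl⟩
    have := bounds i
    rw [point_mem_adjacency]
    omega
  · obtain ⟨c, d, rfl⟩ := exists_eq_point x
    rw [point_mem_adjacency] at hx
    obtain ⟨i, hi⟩ := surj (c - a) (Finset.mem_Icc.2 (by omega)) (d - b)
      (Finset.mem_Icc.2 (by omega)) (by omega)
    exact ⟨i, point_inj.2 (by omega)⟩
  · have := succ i
    rw [point_mem_adjacency]
    omega

theorem exists_isLink_of_mixed {a b : ℤ} (h : (a + b) % 2 = 1) :
    ∃ r : ZMod 4 → DigitalPlane, IsLink (point a b) r := by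
  obtain ⟨dx, dy, inj, axial, surj, succ⟩ : ∃ dx dy : Fin 4 → ℤ,
      (∀ i j, dx i = dx j → dy i = dy j → i = j) ∧
      (∀ i, (dx i = 0 ∧ (dy i = 1 ∨ dy i = -1)) ∨ (dy i = 0 ∧ (dx i = 1 ∨ dx i = -1))) ∧
      (∀ s ∈ Finset.Icc (-1) 1, ∀ t ∈ Finset.Icc (-1) 1, s ≠ 0 ∨ t ≠ 0 → s = 0 ∨ t = 0 →
        ∃ i, dx i = s ∧ dy i = t) ∧
      ∀ i, (dx (i + 1) = dx i + 1 ∨ dx i = dx (i + 1) + 1) ∧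
        (dy (i + 1) = dy i + 1 ∨ dy i = dy (i + 1) + 1) :=
    ⟨![1, 0, -1, 0], ![0, 1, 0, -1], by decide⟩
  refine ⟨fun i => point (a + dx i) (b + dy i), fun i j hij => ?_,
    Subset.antisymm ?_ fun x hx => ?_, fun i => ?_⟩
  · have hij := point_inj.1 hij
    exact inj i j (by omega) (by omega)
  · rintro _ ⟨i, rfl⟩
    have := axial i
    rw [point_mem_adjacency]
    omega
  · obtain ⟨c, d, rfl⟩ := exists_eq_point x
    rw [point_mem_adjacency] at hx
    obtain ⟨i, hi⟩ := surj (c - a) (Finset.mem_Icc.2 (by omega)) (d - b)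
      (Finset.mem_Icc.2 (by omega)) (by omega) (by omega)
    exact ⟨i, point_inj.2 (by omega)⟩
  · have hi := succ i
    have := axial i
    rw [point_mem_adjacency]
    omega

theorem exists_isLink (x : DigitalPlane) :
    ∃ n ≥ 3, ∃ r : ZMod n → DigitalPlane, IsLink x r := by
  obtain ⟨a, b, rfl⟩ := exists_eq_point x
  rcases Int.emod_two_eq_zero_or_one (a + b) with h | h
  · exact ⟨8, by simp, exists_isLink_of_pure h⟩
  · exact ⟨4, by simp, exists_isLink_of_mixed h⟩

theorem connectedComponentIn_eq_of_path {S : Set X} {f : ℕ → X} {k m : ℕ} (hkm : k ≤ m)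
    (hf : ∀ i ∈ Icc k m, f i ∈ S) (hadj : ∀ i, f (i + 1) ∈ adjacency (f i)) :
    connectedComponentIn S (f k) = connectedComponentIn S (f m) := by
  induction m, hkm using Nat.le_induction with
  | base => rfl
  | succ m hkm ih =>
    rw [ih fun i hi => hf i ⟨hi.1, hi.2.trans m.le_succ⟩]
    exact connectedComponentIn_eq_of_mem_adjacency (hf m ⟨hkm, m.le_succ⟩)
      (hf _ ⟨hkm.trans m.le_succ, le_rfl⟩) (hadj m)

theorem IsLink.exists_enumeration {x y : X} {n : ℕ} [NeZero n] {r : ZMod n → X} (hr : IsLink x r)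
    (hy : y ∈ adjacency x) :
    ∃ f : ℕ → X, f 0 = y ∧ f n = y ∧ InjOn f (Iio n) ∧ f '' Iio n = adjacency x ∧
      ∀ k, f (k + 1) ∈ adjacency (f k) := by
  obtain ⟨i, rfl⟩ : y ∈ range r := hr.range_eq ▸ hy
  refine ⟨fun k => r (i + k), by simp, by simp, fun k hk m hm h => ?_, ?_, fun k => ?_⟩
  · simpa [ZMod.natCast_eq_natCast_iff', Nat.mod_eq_of_lt hk, Nat.mod_eq_of_lt hm] using
      hr.injective h
  · rw [← hr.range_eq]
    refine Subset.antisymm (image_subset_iff.2 fun k _ => mem_range_self _) ?_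
    rintro _ ⟨j, rfl⟩
    exact ⟨(j - i).val, ZMod.val_lt _, by simp⟩
  · simpa [add_assoc] using hr.succ_mem_adjacency (i + k)

/-- The points of `J` other than `y` cut the link of `x` at most once, so every point of the link
outside `J` can be reached along it from one of the two neighbours of `y`. -/
theorem IsLink.exists_common_neighbours {x y : X} {n : ℕ} (hn : 3 ≤ n) {r : ZMod n → X}
    (hr : IsLink x r) {J : Set X} (hy : y ∈ adjacency x) (hyJ : y ∈ J)
    (hJ : ((adjacency x ∩ J) \ {y}).Subsingleton) :
    ∃ u v, u ≠ v ∧ u ∈ adjacency x ∩ adjacency y ∧ v ∈ adjacency x ∩ adjacency y ∧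
      ∀ q ∈ adjacency x \ J, connectedComponentIn Jᶜ q = connectedComponentIn Jᶜ u ∨
        connectedComponentIn Jᶜ q = connectedComponentIn Jᶜ v := by
  have : NeZero n := ⟨by omega⟩
  obtain ⟨f, rfl, f_last, f_inj, f_image, f_succ⟩ := hr.exists_enumeration hy
  have f_mem : ∀ k < n, f k ∈ adjacency x := fun k hk => f_image ▸ mem_image_of_mem f hk
  have mem_adjacency_last : f (n - 1) ∈ adjacency (f 0) := by
    rw [mem_adjacency_comm, ← f_last, ← Nat.sub_add_cancel (show 1 ≤ n by omega)]
    exact f_succ (n - 1)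
  refine ⟨f 1, f (n - 1), f_inj.ne (show 1 < n by omega) (show n - 1 < n by omega) (by omega),
    ⟨f_mem 1 (by omega), f_succ 0⟩, ⟨f_mem (n - 1) (by omega), mem_adjacency_last⟩, ?_⟩
  rintro q ⟨hq, hqJ⟩
  obtain ⟨k, hk : k < n, rfl⟩ := f_image ▸ hq
  have hk0 : k ≠ 0 := by
    rintro rfl
    exact hqJ hyJ
  by_cases hleft : ∀ m ∈ Icc 1 k, f m ∈ Jᶜ
  · exact .inl (connectedComponentIn_eq_of_path (by omega) hleft f_succ).symm
  · refine .inr (connectedComponentIn_eq_of_path (by omega) (fun m hm hmJ => hleft ?_) f_succ)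
    rintro l ⟨hl1, hlk⟩ hlJ
    have hmem : ∀ j, 1 ≤ j → j < n → f j ∈ J → f j ∈ (adjacency x ∩ J) \ {f 0} :=
      fun j h1 hjn hj => ⟨⟨f_mem j hjn, hj⟩,
        f_inj.ne hjn (show 0 < n by omega) (Nat.one_le_iff_ne_zero.1 h1)⟩
    have hlm : l = m := f_inj (hlk.trans_lt hk) (show m < n by grind)
      (hJ (hmem l hl1 (by omega) hlJ) (hmem m (by grind) (by grind) hmJ))
    exact hqJ (by rwa [show k = m by grind])

end Link

section Degree

variable {X : Type*} [TopologicalSpace X] {J : Set X} {x y : X}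

/-- A finite set each of whose points has an even number of neighbours in the set, so that the
edges of its adjacency graph form a cycle modulo 2. -/
structure HasEvenDegrees (J : Set X) : Prop where
  finite : J.Finite
  even_ncard : ∀ x ∈ J, Even (adjacency x ∩ J).ncard

theorem IsJordanCurve.hasEvenDegrees (hJ : IsJordanCurve J) : HasEvenDegrees J :=
  ⟨hJ.finite, fun x hx => by rw [ncard, hJ.encard_adjacency_inter hx]; exact even_two⟩

open Classical in
/-- The indicator, modulo 2, of the edges of the adjacency graph of `J`. -/
noncomputable def edge (J : Set X) (x y : X) : ZMod 2 :=
  if x ∈ J ∧ y ∈ J ∧ y ∈ adjacency x then 1 else 0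

theorem edge_comm (J : Set X) (x y : X) : edge J x y = edge J y x := by
  classical
  exact if_congr (by rw [mem_adjacency_comm, and_left_comm]) rfl rfl

theorem edge_eq_one (hx : x ∈ J) (hy : y ∈ J) (h : y ∈ adjacency x) : edge J x y = 1 :=
  if_pos ⟨hx, hy, h⟩

theorem edge_of_notMem_left (hx : x ∉ J) : edge J x y = 0 := if_neg fun h => hx h.1

theorem edge_of_notMem_right (hy : y ∉ J) : edge J x y = 0 := if_neg fun h => hy h.2.1

theorem edge_of_notMem_adjacency (h : y ∉ adjacency x) : edge J x y = 0 := if_neg fun h' => h h'.2.2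

theorem HasEvenDegrees.sum_edge_eq_zero (hJ : HasEvenDegrees J) {ι : Type*} {s : Finset ι}
    {f : ι → X} (hf : InjOn f s) (hs : adjacency x ⊆ f '' s) : ∑ i ∈ s, edge J x (f i) = 0 := by
  classical
  by_cases hx : x ∈ J
  · have himage : f '' (s.filter fun i => f i ∈ J ∧ f i ∈ adjacency x) = adjacency x ∩ J := by
      ext y
      constructor
      · rintro ⟨i, hi, rfl⟩
        have := (Finset.mem_filter.1 hi).2
        exact this.symm
      · rintro ⟨hy, hyJ⟩
        obtain ⟨i, hi, rfl⟩ := hs hy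
        exact ⟨i, Finset.mem_filter.2 ⟨hi, hyJ, hy⟩, rfl⟩
    have hcard := (hf.mono (Finset.coe_subset.2
      (Finset.filter_subset (fun i => f i ∈ J ∧ f i ∈ adjacency x) s))).ncard_image
    rw [himage, ncard_coe_finset] at hcard
    simp only [edge, hx, true_and, Finset.sum_boole]
    rw [← hcard, ZMod.natCast_eq_zero_iff_even]
    exact hJ.even_ncard x hx
  · exact Finset.sum_eq_zero fun i _ => edge_of_notMem_left hx

end Degree

section Colour

variable {J : Set DigitalPlane} {a b : ℤ}

theorem edge_point_of_mixed (h : (a + b) % 2 = 1) {c d : ℤ} (hc : c ≠ a) (hd : d ≠ b) :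
    edge J (point a b) (point c d) = 0 :=
  edge_of_notMem_adjacency (by rw [point_mem_adjacency]; omega)

/-- The number modulo 2 of edges of `J` leading from `point a b` to the row above it. -/
noncomputable def upDegree (J : Set DigitalPlane) (a b : ℤ) : ZMod 2 :=
  edge J (point a b) (point (a - 1) (b + 1)) + edge J (point a b) (point a (b + 1)) +
    edge J (point a b) (point (a + 1) (b + 1))

/-- The number modulo 2 of crossings of `J` with a horizontal ray that issues from a position
slightly above and to the right of `x`. It is meaningful for finite `J` only: `∑ᶠ` is zero on an
infinite support. -/
noncomputable def colour (J : Set DigitalPlane) (x : DigitalPlane) : ZMod 2 :=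
  ∑ᶠ t ∈ Ioi x.1.toInt, upDegree J t x.2.toInt

theorem upDegree_of_notMem (h : point a b ∉ J) : upDegree J a b = 0 := by
  simp only [upDegree, edge_of_notMem_left h, add_zero]

theorem HasEvenDegrees.colour_east (hJ : HasEvenDegrees J) (a b : ℤ) :
    colour J (point a b) = upDegree J (a + 1) b + colour J (point (a + 1) b) := by
  have hfin : (Ioi (a + 1) ∩ Function.support fun t => upDegree J t b).Finite := by
    refine Finite.subset (hJ.finite.preimage (f := fun t => point t b) fun s _ t _ h =>
      (point_inj.1 h).1) fun t ht => ?_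
    by_contra h
    exact ht.2 (upDegree_of_notMem h)
  change ∑ᶠ t ∈ Ioi a, upDegree J t b = _
  have hIoi : Ioi a = insert (a + 1) (Ioi (a + 1)) := by
    ext t
    simp only [mem_Ioi, mem_insert_iff]
    omega
  rw [hIoi, finsum_mem_insert' _ (by simp) hfin]
  rfl

theorem HasEvenDegrees.colour_east_of_notMem (hJ : HasEvenDegrees J) (h : point (a + 1) b ∉ J) :
    colour J (point a b) = colour J (point (a + 1) b) := by
  rw [hJ.colour_east, upDegree_of_notMem h, zero_add]

theorem HasEvenDegrees.sum_edge_point (hJ : HasEvenDegrees J) (a b : ℤ) :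
    upDegree J a b + edge J (point a b) (point (a - 1) b) + edge J (point a b) (point (a + 1) b) +
      edge J (point a b) (point (a - 1) (b - 1)) + edge J (point a b) (point a (b - 1)) +
      edge J (point a b) (point (a + 1) (b - 1)) = 0 := by
  have hsum := hJ.sum_edge_eq_zero (x := point a b)
    (s := Finset.Icc (-1) 1 ×ˢ Finset.Icc (-1) 1) (f := fun d : ℤ × ℤ => point (a + d.1) (b + d.2))
    (fun d _ d' _ h => by
      have := point_inj.1 h
      exact Prod.ext (by omega) (by omega))
    (fun y hy => by
      obtain ⟨c, d, rfl⟩ := exists_eq_point y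
      rw [point_mem_adjacency] at hy
      exact ⟨(c - a, d - b), by simp; omega, point_inj.2 (by simp)⟩)
  have hself : edge J (point a b) (point a b) = 0 :=
    edge_of_notMem_adjacency fun h => h.1 rfl
  rw [Finset.sum_product, show Finset.Icc (-1 : ℤ) 1 = {-1, 0, 1} from rfl] at hsum
  simp only [Finset.mem_insert, Finset.mem_singleton, Finset.sum_insert, Finset.sum_singleton,
    reduceCtorEq, Int.reduceNeg, zero_ne_one, or_self, not_false_eq_true, add_zero,
    ← sub_eq_add_neg, hself] at hsum
  rw [← hsum, upDegree]
  ring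

theorem HasEvenDegrees.colour_north (hJ : HasEvenDegrees J) (a b : ℤ) :
    colour J (point a (b + 1)) = colour J (point a b) +
      edge J (point a (b + 1)) (point (a + 1) (b + 1)) +
      edge J (point a b) (point (a + 1) (b + 1)) + edge J (point (a + 1) b) (point a (b + 1)) := by
  obtain ⟨R, hR⟩ : ∃ R, ∀ c d, point c d ∈ J → c ≤ R := by
    obtain ⟨R, hR⟩ := (hJ.finite.image fun x => x.1.toInt).bddAbove
    exact ⟨R, fun c d h => hR ⟨_, h, rfl⟩⟩
  have notMem : ∀ c d, R < c → point c d ∉ J := fun c d hc h => (hR c d h).not_gt hc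
  have base : ∀ a, R ≤ a → colour J (point a (b + 1)) = colour J (point a b) +
      edge J (point a (b + 1)) (point (a + 1) (b + 1)) +
      edge J (point a b) (point (a + 1) (b + 1)) +
      edge J (point (a + 1) b) (point a (b + 1)) := by
    intro a ha
    have colour_eq_zero : ∀ d, colour J (point a d) = 0 := fun d =>
      finsum_mem_eq_zero_of_forall_eq_zero fun t ht =>
        upDegree_of_notMem (notMem t d (ha.trans_lt ht))
    rw [colour_eq_zero, colour_eq_zero, edge_of_notMem_right (notMem _ _ (by omega)),
      edge_of_notMem_right (notMem _ _ (by omega)), edge_of_notMem_left (notMem _ _ (by omega))]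
    simp
  rcases le_total R a with ha | ha
  · exact base a ha
  induction a, ha using Int.leInductionDown with
  | base => exact base R le_rfl
  | pred a _ ih =>
    have heast := hJ.colour_east (a - 1)
    have hdeg := hJ.sum_edge_point a (b + 1)
    simp only [sub_add_cancel, add_sub_cancel_right] at heast hdeg ⊢
    rw [heast, heast, ih]
    rw [edge_comm J (point a (b + 1)) (point (a - 1) (b + 1)),
      edge_comm J (point a (b + 1)) (point (a - 1) b), edge_comm J (point a (b + 1)) (point a b),
      edge_comm J (point a (b + 1)) (point (a + 1) b)] at hdeg
    rw [upDegree.eq_def J a b]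
    linear_combination hdeg - (edge J (point a b) (point (a - 1) (b + 1)) +
      edge J (point a b) (point a (b + 1)) + edge J (point (a - 1) (b + 1)) (point a (b + 1)) +
      edge J (point (a - 1) b) (point a (b + 1))) * CharTwo.two_eq_zero (R := ZMod 2)

theorem HasEvenDegrees.colour_north_of_notMem (hJ : HasEvenDegrees J)
    (h : point a (b + 1) ∉ J) :
    colour J (point a (b + 1)) =
      colour J (point a b) + edge J (point a b) (point (a + 1) (b + 1)) := by
  rw [hJ.colour_north, edge_of_notMem_left h, edge_of_notMem_right h, add_zero, add_zero]

theorem HasEvenDegrees.colour_eq_of_mem_adjacency (hJ : HasEvenDegrees J) {x y : DigitalPlane}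
    (h : y ∈ adjacency x) (hx : x ∉ J) (hy : y ∉ J) : colour J x = colour J y := by
  refine adjacency_induction (P := fun x y => x ∉ J → y ∉ J → colour J x = colour J y)
    (fun x y h hy hx => (h hx hy).symm) (fun a b _ h => hJ.colour_east_of_notMem h)
    (fun a b h h' => ?_) (fun a b hab h h' => ?_) (fun a b hab h h' => ?_) h hx hy
  · rw [hJ.colour_north_of_notMem h', edge_of_notMem_left h, add_zero]
  · rw [← hJ.colour_east_of_notMem h', hJ.colour_north, edge_of_notMem_left h,
      edge_of_notMem_right h', edge_point_of_mixed (by omega) (by omega) (by omega)]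
    simp only [add_zero]
  · rw [← hJ.colour_east_of_notMem h, hJ.colour_north_of_notMem h',
      edge_point_of_mixed hab (by omega) (by omega), add_zero]

end Colour

section Crossing

variable {J : Set DigitalPlane} {a b : ℤ}

theorem ext_point {S T : Set DigitalPlane} (h : ∀ c d, point c d ∈ S ↔ point c d ∈ T) : S = T :=
  ext fun x => by
    obtain ⟨c, d, rfl⟩ := exists_eq_point x
    exact h c d

theorem HasEvenDegrees.colour_ne_of_horizontal_edge (hJ : HasEvenDegrees J)
    (hx : point a b ∈ J) (hy : point (a + 1) b ∈ J) :
    ∃ p q, adjacency (point a b) ∩ adjacency (point (a + 1) b) = {p, q} ∧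
      (p ∉ J → q ∉ J → colour J p ≠ colour J q) := by
  have north := hJ.colour_north a (b - 1)
  rw [sub_add_cancel, edge_eq_one hx hy (by rw [point_mem_adjacency]; omega)] at north
  rcases Int.emod_two_eq_zero_or_one (a + b) with hab | hab
  · refine ⟨point (a + 1) (b + 1), point (a + 1) (b - 1), ext_point fun c d => ?_, fun hp hq => ?_⟩
    · simp only [mem_inter_iff, mem_insert_iff, mem_singleton_iff, point_mem_adjacency, point_inj]
      omega
    · rw [← hJ.colour_east_of_notMem hp, ← hJ.colour_east_of_notMem hq, hJ.colour_north, north,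
        edge_of_notMem_right hp, edge_of_notMem_right hp, edge_of_notMem_left hq,
        edge_point_of_mixed (by omega) (by omega) (by omega),
        edge_point_of_mixed (by omega) (by omega) (by omega)]
      simp
  · refine ⟨point a (b + 1), point a (b - 1), ext_point fun c d => ?_, fun hp hq => ?_⟩
    · simp only [mem_inter_iff, mem_insert_iff, mem_singleton_iff, point_mem_adjacency, point_inj]
      omega
    · rw [hJ.colour_north_of_notMem hp, north, edge_of_notMem_left hq,
        edge_point_of_mixed hab (by omega) (by omega),
        edge_point_of_mixed (by omega) (by omega) (by omega)]
      simp

theorem HasEvenDegrees.colour_ne_of_vertical_edge (hJ : HasEvenDegrees J)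
    (hx : point a b ∈ J) (hy : point a (b + 1) ∈ J) :
    ∃ p q, adjacency (point a b) ∩ adjacency (point a (b + 1)) = {p, q} ∧
      (p ∉ J → q ∉ J → colour J p ≠ colour J q) := by
  have east := hJ.colour_east (a - 1) b
  rw [sub_add_cancel, upDegree, edge_eq_one hx hy (by rw [point_mem_adjacency]; omega)] at east
  rcases Int.emod_two_eq_zero_or_one (a + b) with hab | hab
  · refine ⟨point (a - 1) (b + 1), point (a + 1) (b + 1), ext_point fun c d => ?_, fun hp hq => ?_⟩
    · simp only [mem_inter_iff, mem_insert_iff, mem_singleton_iff, point_mem_adjacency, point_inj]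
      omega
    · have north := hJ.colour_north_of_notMem hp
      rw [sub_add_cancel, east, edge_of_notMem_right hp, edge_of_notMem_right hq,
        edge_point_of_mixed (by omega) (by omega) (by omega)] at north
      rw [north, ← hJ.colour_east_of_notMem hq, hJ.colour_north, edge_of_notMem_right hq,
        edge_of_notMem_right hq, edge_point_of_mixed (by omega) (by omega) (by omega)]
      simp
  · refine ⟨point (a - 1) b, point (a + 1) b, ext_point fun c d => ?_, fun _ hq => ?_⟩
    · simp only [mem_inter_iff, mem_insert_iff, mem_singleton_iff, point_mem_adjacency, point_inj]
      omega
    · rw [east, ← hJ.colour_east_of_notMem hq, edge_point_of_mixed hab (by omega) (by omega),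
        edge_point_of_mixed hab (by omega) (by omega)]
      simp

theorem HasEvenDegrees.colour_ne_of_diagonal_edge (hJ : HasEvenDegrees J)
    (hab : (a + b) % 2 = 0) (hx : point a b ∈ J) (hy : point (a + 1) (b + 1) ∈ J) :
    ∃ p q, adjacency (point a b) ∩ adjacency (point (a + 1) (b + 1)) = {p, q} ∧
      (p ∉ J → q ∉ J → colour J p ≠ colour J q) := by
  refine ⟨point a (b + 1), point (a + 1) b, ext_point fun c d => ?_, fun hp hq => ?_⟩
  · simp only [mem_inter_iff, mem_insert_iff, mem_singleton_iff, point_mem_adjacency, point_inj]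
    omega
  · rw [hJ.colour_north_of_notMem hp, ← hJ.colour_east_of_notMem hq,
      edge_eq_one hx hy (by rw [point_mem_adjacency]; omega)]
    simp

theorem HasEvenDegrees.colour_ne_of_antidiagonal_edge (hJ : HasEvenDegrees J)
    (hab : (a + b) % 2 = 1) (hx : point (a + 1) b ∈ J) (hy : point a (b + 1) ∈ J) :
    ∃ p q, adjacency (point (a + 1) b) ∩ adjacency (point a (b + 1)) = {p, q} ∧
      (p ∉ J → q ∉ J → colour J p ≠ colour J q) := by
  refine ⟨point (a + 1) (b + 1), point a b, ext_point fun c d => ?_, fun hp hq => ?_⟩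
  · simp only [mem_inter_iff, mem_insert_iff, mem_singleton_iff, point_mem_adjacency, point_inj]
    omega
  · rw [← hJ.colour_east_of_notMem hp, hJ.colour_north, edge_of_notMem_right hp,
      edge_of_notMem_left hq, edge_eq_one hx hy (by rw [point_mem_adjacency]; omega)]
    simp

theorem HasEvenDegrees.colour_ne_of_edge (hJ : HasEvenDegrees J) {x y u v : DigitalPlane}
    (hx : x ∈ J) (hy : y ∈ J) (hxy : y ∈ adjacency x) (hu : u ∈ (adjacency x ∩ adjacency y) \ J)
    (hv : v ∈ (adjacency x ∩ adjacency y) \ J) (huv : u ≠ v) : colour J u ≠ colour J v := by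
  obtain ⟨p, q, hpq, hne⟩ : ∃ p q, adjacency x ∩ adjacency y = {p, q} ∧
      (p ∉ J → q ∉ J → colour J p ≠ colour J q) := by
    refine adjacency_induction (P := fun x y => x ∈ J → y ∈ J → ∃ p q,
        adjacency x ∩ adjacency y = {p, q} ∧ (p ∉ J → q ∉ J → colour J p ≠ colour J q))
      (fun x y h hy hx => ?_) (fun a b => hJ.colour_ne_of_horizontal_edge)
      (fun a b => hJ.colour_ne_of_vertical_edge) (fun a b => hJ.colour_ne_of_diagonal_edge)
      (fun a b => hJ.colour_ne_of_antidiagonal_edge) hxy hx hy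
    rw [inter_comm]
    exact h hx hy
  rw [hpq] at hu hv
  obtain ⟨rfl | rfl, huJ⟩ := hu <;> obtain ⟨rfl | rfl, hvJ⟩ := hv
  exacts [absurd rfl huv, hne huJ hvJ, (hne hvJ huJ).symm, absurd rfl huv]

end Crossing

section JordanCurveTheorem

variable {J : Set DigitalPlane} {x p q : DigitalPlane}

theorem IsJordanCurve.exists_separated_common_neighbours (hJ : IsJordanCurve J) {y : DigitalPlane}
    (hx : x ∈ J) (hy : y ∈ J) (hxy : y ∈ adjacency x) :
    ∃ u ∈ (adjacency x ∩ adjacency y) \ J, ∃ v ∈ (adjacency x ∩ adjacency y) \ J,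
      colour J u ≠ colour J v ∧
      ∀ q ∈ adjacency x \ J, connectedComponentIn Jᶜ q = connectedComponentIn Jᶜ u ∨
        connectedComponentIn Jᶜ q = connectedComponentIn Jᶜ v := by
  obtain ⟨n, hn, r, hr⟩ := exists_isLink x
  have hother : ((adjacency x ∩ J) \ {y}).Subsingleton := by
    rintro u ⟨⟨hxu, hu⟩, huy⟩ v ⟨⟨hxv, hv⟩, hvy⟩
    rcases hJ.not_three_neighbours hx hy hu hv hxy hxu hxv with h | h | h
    exacts [absurd h.symm huy, absurd h.symm hvy, h]
  obtain ⟨u, v, huv, hu, hv, hcomp⟩ := hr.exists_common_neighbours hn hxy hy hother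
  have notMem : ∀ z ∈ adjacency x ∩ adjacency y, z ∉ J := fun z hz hzJ =>
    hJ.not_triangle hx hy hzJ hxy hz.1 hz.2
  have hu' := And.intro hu (notMem u hu)
  have hv' := And.intro hv (notMem v hv)
  exact ⟨u, hu', v, hv', hJ.hasEvenDegrees.colour_ne_of_edge hx hy hxy hu' hv' huv, hcomp⟩

theorem IsJordanCurve.exists_common_neighbour_colour_eq (hJ : IsJordanCurve J) {y : DigitalPlane}
    (hx : x ∈ J) (hy : y ∈ J) (hxy : y ∈ adjacency x) (i : ZMod 2) :
    ∃ q ∈ (adjacency x ∩ adjacency y) \ J, colour J q = i := by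
  obtain ⟨u, hu, v, hv, hne, -⟩ := hJ.exists_separated_common_neighbours hx hy hxy
  have : colour J u = i ∨ colour J v = i := by
    generalize colour J u = c at *
    generalize colour J v = d at *
    revert c d i
    decide
  rcases this with h | h
  exacts [⟨u, hu, h⟩, ⟨v, hv, h⟩]

theorem IsJordanCurve.colour_eq_of_connectedComponentIn_eq (hJ : IsJordanCurve J) (hp : p ∉ J)
    (hq : q ∉ J) (h : connectedComponentIn Jᶜ p = connectedComponentIn Jᶜ q) :
    colour J p = colour J q := by
  refine isPreconnected_induction (Q := fun z => colour J p = colour J z)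
    (isPreconnected_connectedComponentIn (x := p) (F := Jᶜ)) (fun u hu v hv huv hcol => ?_)
    (mem_connectedComponentIn hp) (h ▸ mem_connectedComponentIn hq) rfl
  exact hcol.trans (hJ.hasEvenDegrees.colour_eq_of_mem_adjacency huv
    (connectedComponentIn_subset _ _ hu) (connectedComponentIn_subset _ _ hv))

theorem IsJordanCurve.connectedComponentIn_eq_of_adjacent (hJ : IsJordanCurve J) (hx : x ∈ J)
    (hp : p ∈ adjacency x \ J) (hq : q ∈ adjacency x \ J) (hcol : colour J p = colour J q) :
    connectedComponentIn Jᶜ p = connectedComponentIn Jᶜ q := by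
  obtain ⟨y, hy, hxy⟩ := hJ.exists_mem_adjacency hx
  obtain ⟨u, hu, v, hv, hne, hcomp⟩ := hJ.exists_separated_common_neighbours hx hy hxy
  rcases hcomp p hp with hpu | hpu <;> rcases hcomp q hq with hqu | hqu
  · rw [hpu, hqu]
  · rw [hJ.colour_eq_of_connectedComponentIn_eq hp.2 hu.2 hpu,
      hJ.colour_eq_of_connectedComponentIn_eq hq.2 hv.2 hqu] at hcol
    exact absurd hcol hne
  · rw [hJ.colour_eq_of_connectedComponentIn_eq hp.2 hv.2 hpu,
      hJ.colour_eq_of_connectedComponentIn_eq hq.2 hu.2 hqu] at hcol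
    exact absurd hcol.symm hne
  · rw [hpu, hqu]

/-- Along an edge `x y` of `J` the component with a given colour is handed over from `x` to `y` by
a common neighbour of that colour. -/
theorem IsJordanCurve.connectedComponentIn_eq_iff (hJ : IsJordanCurve J) (hp : p ∉ J)
    (hq : q ∉ J) :
    connectedComponentIn Jᶜ p = connectedComponentIn Jᶜ q ↔ colour J p = colour J q := by
  refine ⟨hJ.colour_eq_of_connectedComponentIn_eq hp hq, fun hcol => ?_⟩
  obtain ⟨x, hx, p', hp', hpp'⟩ := exists_adjacent_connectedComponentIn_eq hJ.1.nonempty hp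
  obtain ⟨y, hy, q', hq', hqq'⟩ := exists_adjacent_connectedComponentIn_eq hJ.1.nonempty hq
  have hcolp : colour J p' = colour J q :=
    (hJ.colour_eq_of_connectedComponentIn_eq hp'.2 hp hpp').trans hcol
  have propagate : ∀ z ∈ adjacency y \ J, colour J z = colour J q →
      connectedComponentIn Jᶜ z = connectedComponentIn Jᶜ p := by
    refine isPreconnected_induction (Q := fun y => ∀ z ∈ adjacency y \ J,
        colour J z = colour J q → connectedComponentIn Jᶜ z = connectedComponentIn Jᶜ p)
      hJ.1.isPreconnected (fun u hu v hv huv h z hz hzq => ?_) hx hy fun z hz hzq => ?_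
    · obtain ⟨w, ⟨⟨huw, hvw⟩, hwJ⟩, hwq⟩ :=
        hJ.exists_common_neighbour_colour_eq hu hv huv (colour J q)
      rw [← h w ⟨huw, hwJ⟩ hwq]
      exact hJ.connectedComponentIn_eq_of_adjacent hv hz ⟨hvw, hwJ⟩ (hzq.trans hwq.symm)
    · rw [← hpp']
      exact hJ.connectedComponentIn_eq_of_adjacent hx hz hp' (hzq.trans hcolp.symm)
  rw [← hqq', propagate q' hq' (hJ.colour_eq_of_connectedComponentIn_eq hq'.2 hq hqq')]

theorem IsJordanCurve.adjacency_inter_nonempty (hJ : IsJordanCurve J) (hx : x ∈ J)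
    {D : Set DigitalPlane} (hD : D ∈ components Jᶜ) : (adjacency x ∩ D).Nonempty := by
  obtain ⟨p, hp, rfl⟩ := hD
  obtain ⟨y, hy, hxy⟩ := hJ.exists_mem_adjacency hx
  obtain ⟨q, ⟨⟨hxq, -⟩, hq⟩, hcol⟩ :=
    hJ.exists_common_neighbour_colour_eq hx hy hxy (colour J p)
  rw [← (hJ.connectedComponentIn_eq_iff hq hp).2 hcol]
  exact ⟨q, hxq, mem_connectedComponentIn hq⟩

theorem IsJordanCurve.encard_components_compl (hJ : IsJordanCurve J) :
    (components Jᶜ).encard = 2 := by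
  obtain ⟨x, hx⟩ := hJ.1.nonempty
  obtain ⟨y, hy, hxy⟩ := hJ.exists_mem_adjacency hx
  obtain ⟨p, ⟨-, hp⟩, hp0⟩ := hJ.exists_common_neighbour_colour_eq hx hy hxy 0
  obtain ⟨q, ⟨-, hq⟩, hq1⟩ := hJ.exists_common_neighbour_colour_eq hx hy hxy 1
  refine encard_eq_two.2 ⟨_, _, fun h => ?_,
    Subset.antisymm ?_ (pair_subset (mem_image_of_mem _ hp) (mem_image_of_mem _ hq))⟩
  · rw [hJ.connectedComponentIn_eq_iff hp hq, hp0, hq1] at h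
    exact zero_ne_one h
  · rintro _ ⟨z, hz, rfl⟩
    have hcol : colour J z = colour J p ∨ colour J z = colour J q := by
      rw [hp0, hq1]
      generalize colour J z = c
      revert c
      decide
    exact hcol.imp (hJ.connectedComponentIn_eq_iff hz hp).2 (hJ.connectedComponentIn_eq_iff hz hq).2

theorem IsJordanCurve.not_adjacency_subset_union (hJ : IsJordanCurve J) (hx : x ∈ J)
    {D : Set DigitalPlane} (hD : D ∈ components Jᶜ) : ¬ adjacency x ⊆ D ∪ J := by
  have hcard : 1 < (components Jᶜ).encard := hJ.encard_components_compl ▸ Nat.one_lt_ofNat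
  obtain ⟨E, hE, hED⟩ := exists_ne_of_one_lt_encard hcard D
  obtain ⟨y, hxy, hyE⟩ := hJ.adjacency_inter_nonempty hx hE
  intro h
  have hyD : y ∈ D := (h hxy).resolve_right (subset_of_mem_components hE hyE)
  exact hED ((eq_connectedComponentIn_of_mem hE hyE).trans
    (eq_connectedComponentIn_of_mem hD hyD).symm)

end JordanCurveTheorem

section Slant

variable {x : DigitalPlane} {p q : ℤ × ℤ}

theorem slant_eq_point (p : ℤ × ℤ) : slant p = point (p.1 + p.2) (p.2 - p.1) := rfl

theorem isPure_point {a b : ℤ} : IsPure (point a b) ↔ (a + b) % 2 = 0 := by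
  simp only [IsPure, point, DigitalLine.toInt, Equiv.symm_apply_apply, Int.even_iff, Int.odd_iff]
  omega

theorem slant_injective : Function.Injective slant := fun p q h => by
  rw [slant_eq_point, slant_eq_point, point_inj] at h
  exact Prod.ext (by omega) (by omega)

theorem isPure_iff_mem_range_slant : IsPure x ↔ x ∈ range slant := by
  obtain ⟨a, b, rfl⟩ := exists_eq_point x
  rw [isPure_point]
  refine ⟨fun h => ⟨((a - b) / 2, (a + b) / 2), ?_⟩, ?_⟩
  · rw [slant_eq_point, point_inj]
    omega
  · rintro ⟨p, hp⟩
    rw [slant_eq_point, point_inj] at hp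
    omega

theorem isPure_slant (p : ℤ × ℤ) : IsPure (slant p) :=
  isPure_iff_mem_range_slant.2 (mem_range_self p)

theorem slant_mem_adjacency_slant : slant q ∈ adjacency (slant p) ↔ FourAdj p q := by
  obtain ⟨a, b⟩ := p
  obtain ⟨c, d⟩ := q
  simp only [slant_eq_point, point_mem_adjacency, FourAdj, Prod.mk.injEq]
  omega

theorem IsMixed.isPure_of_mem_adjacency (hx : IsMixed x) {y : DigitalPlane}
    (hy : y ∈ adjacency x) : IsPure y := by
  obtain ⟨a, b, rfl⟩ := exists_eq_point x
  obtain ⟨c, d, rfl⟩ := exists_eq_point y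
  rw [IsMixed, isPure_point] at hx
  rw [point_mem_adjacency] at hy
  rw [isPure_point]
  omega

theorem IsMixed.exists_specializes (hx : IsMixed x) : ∃ y, y ⤳ x ∧ y ≠ x := by
  obtain ⟨a, b, rfl⟩ := exists_eq_point x
  rw [IsMixed, isPure_point] at hx
  rcases Int.emod_two_eq_zero_or_one a with ha | ha
  · exact ⟨point (a + 1) b, by rw [point_specializes_point]; omega, by simp [point_inj]⟩
  · exact ⟨point a (b + 1), by rw [point_specializes_point]; omega, by simp [point_inj]⟩

theorem IsMixed.exists_specialization (hx : IsMixed x) : ∃ y, x ⤳ y ∧ y ≠ x := by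
  obtain ⟨a, b, rfl⟩ := exists_eq_point x
  rw [IsMixed, isPure_point] at hx
  rcases Int.emod_two_eq_zero_or_one a with ha | ha
  · exact ⟨point a (b + 1), by rw [point_specializes_point]; omega, by simp [point_inj]⟩
  · exact ⟨point (a + 1) b, by rw [point_specializes_point]; omega, by simp [point_inj]⟩

end Slant

section SlantStar

variable {J T D : Set DigitalPlane} {x : DigitalPlane}

theorem mem_slant_image_preimage : x ∈ slant '' (slant ⁻¹' T) ↔ x ∈ T ∧ IsPure x := by
  rw [image_preimage_eq_inter_range, mem_inter_iff, isPure_iff_mem_range_slant]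

theorem IsPure.mem_slantStar_preimage (hx : IsPure x) : x ∈ slantStar (slant ⁻¹' T) ↔ x ∈ T := by
  rw [slantStar, mem_union, mem_slant_image_preimage]
  simp [IsMixed, hx]

theorem IsMixed.mem_slantStar_preimage (hx : IsMixed x) :
    x ∈ slantStar (slant ⁻¹' T) ↔
      (∀ y, y ⤳ x → y ≠ x → y ∈ T) ∨ (∀ y, x ⤳ y → y ≠ x → y ∈ T) := by
  have mem_iff : ∀ y, y ⤳ x ∨ x ⤳ y →
      (y ∈ slant '' (slant ⁻¹' T) ∪ {x} ↔ (y ≠ x → y ∈ T)) := fun y h => by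
    rw [mem_union, mem_slant_image_preimage, mem_singleton_iff]
    obtain rfl | hne := eq_or_ne y x
    · simp
    · have := hx.isPure_of_mem_adjacency (mem_adjacency_iff.2 ⟨hne, h.symm⟩)
      simp [hne, this]
  have notMem : x ∉ slant '' (slant ⁻¹' T) := fun h => hx (mem_slant_image_preimage.1 h).2
  rw [slantStar, mem_union, or_iff_right notMem, mem_ofPred_eq, and_iff_right hx]
  refine or_congr (forall_congr' fun y => ?_) (forall_congr' fun y => ?_)
  · rw [mem_nhdsKer_singleton]
    exact imp_congr_right fun h => mem_iff y (.inl h)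
  · rw [← specializes_iff_mem_closure]
    exact imp_congr_right fun h => mem_iff y (.inr h)

theorem mem_mixedFill_preimage :
    x ∈ mixedFill (slant ⁻¹' T) J ↔ IsMixed x ∧ adjacency x ⊆ T ∪ J := by
  refine and_congr_right fun hx => forall₂_congr fun y hy => ?_
  rw [mem_union, mem_union, mem_slant_image_preimage,
    and_iff_left (hx.isPure_of_mem_adjacency hy)]

theorem IsMixed.exists_specializes_notMem (hx : IsMixed x)
    (hstar : slantStar (slant ⁻¹' J) = J) (hxJ : x ∉ J) : ∃ y, y ⤳ x ∧ y ≠ x ∧ y ∉ J := by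
  rw [← hstar, hx.mem_slantStar_preimage] at hxJ
  push Not at hxJ
  exact hxJ.1

theorem IsMixed.exists_specialization_notMem (hx : IsMixed x)
    (hstar : slantStar (slant ⁻¹' J) = J) (hxJ : x ∉ J) : ∃ y, x ⤳ y ∧ y ≠ x ∧ y ∉ J := by
  rw [← hstar, hx.mem_slantStar_preimage] at hxJ
  push Not at hxJ
  exact hxJ.2

theorem IsMixed.exists_mem_adjacency_notMem (hx : IsMixed x)
    (hstar : slantStar (slant ⁻¹' J) = J) (hxJ : x ∉ J) : ∃ y ∈ adjacency x, y ∉ J := by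
  obtain ⟨y, hyx, hne, hyJ⟩ := hx.exists_specializes_notMem hstar hxJ
  exact ⟨y, mem_adjacency_iff.2 ⟨hne, .inr hyx⟩, hyJ⟩

/-- Every point of `N(x)` other than `x` is adjacent to every point of `cl(x)` other than `x`, and
the complement of `J` meets both. -/
theorem IsMixed.exists_common_neighbour_notMem (hx : IsMixed x)
    (hstar : slantStar (slant ⁻¹' J) = J) (hxJ : x ∉ J) {p q : DigitalPlane}
    (hp : p ∈ adjacency x) (hq : q ∈ adjacency x \ J) :
    ∃ m ∈ adjacency x \ J, (m = p ∨ m ∈ adjacency p) ∧ (m = q ∨ q ∈ adjacency m) := by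
  obtain ⟨y, hyx, hy_ne, hyJ⟩ := hx.exists_specializes_notMem hstar hxJ
  obtain ⟨z, hxz, hz_ne, hzJ⟩ := hx.exists_specialization_notMem hstar hxJ
  have hy : y ∈ adjacency x := mem_adjacency_iff.2 ⟨hy_ne, .inr hyx⟩
  have hz : z ∈ adjacency x := mem_adjacency_iff.2 ⟨hz_ne, .inl hxz⟩
  obtain ⟨hp_ne, hxp | hpx⟩ := mem_adjacency_iff.1 hp <;>
    obtain ⟨hq_ne, hxq | hqx⟩ := mem_adjacency_iff.1 hq.1
  · exact ⟨y, ⟨hy, hyJ⟩, .inr (mem_adjacency_comm.1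
      (mem_adjacency_of_specializes_of_specializes hyx hy_ne hxp)),
      .inr (mem_adjacency_of_specializes_of_specializes hyx hy_ne hxq)⟩
  · exact ⟨q, hq, .inr (mem_adjacency_comm.1
      (mem_adjacency_of_specializes_of_specializes hqx hq_ne hxp)), .inl rfl⟩
  · exact ⟨q, hq, .inr (mem_adjacency_of_specializes_of_specializes hpx hp_ne hxq), .inl rfl⟩
  · exact ⟨z, ⟨hz, hzJ⟩, .inr (mem_adjacency_of_specializes_of_specializes hpx hp_ne hxz),
      .inr (mem_adjacency_comm.1
        (mem_adjacency_of_specializes_of_specializes hqx hq_ne hxz))⟩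

theorem IsMixed.adjacency_subset_of_mem_slantStar (hx : IsMixed x)
    (hstar : slantStar (slant ⁻¹' J) = J) (hDJ : Disjoint D J) (hxJ : x ∈ J)
    (hxD : x ∈ slantStar (slant ⁻¹' D)) : adjacency x ⊆ D ∪ J := by
  rw [← hstar, hx.mem_slantStar_preimage] at hxJ
  rw [hx.mem_slantStar_preimage] at hxD
  intro y hy
  obtain ⟨hyx, h⟩ := mem_adjacency_iff.1 hy
  rcases hxD with hD | hD <;> rcases hxJ with hJ | hJ
  · obtain ⟨z, hzx, hne⟩ := hx.exists_specializes
    exact (disjoint_left.1 hDJ (hD z hzx hne) (hJ z hzx hne)).elim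
  · exact h.symm.imp (hD y · hyx) (hJ y · hyx)
  · exact h.imp (hD y · hyx) (hJ y · hyx)
  · obtain ⟨z, hxz, hne⟩ := hx.exists_specialization
    exact (disjoint_left.1 hDJ (hD z hxz hne) (hJ z hxz hne)).elim

theorem IsMixed.exists_mem_adjacency_of_mem_slantStar (hx : IsMixed x)
    (hxD : x ∈ slantStar (slant ⁻¹' D)) : ∃ y ∈ D, y ∈ adjacency x := by
  rcases hx.mem_slantStar_preimage.1 hxD with h | h
  · obtain ⟨y, hyx, hne⟩ := hx.exists_specializes
    exact ⟨y, h y hyx hne, mem_adjacency_iff.2 ⟨hne, .inr hyx⟩⟩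
  · obtain ⟨y, hxy, hne⟩ := hx.exists_specialization
    exact ⟨y, h y hxy hne, mem_adjacency_iff.2 ⟨hne, .inl hxy⟩⟩

theorem slantStar_union_mixedFill_preimage (hstar : slantStar (slant ⁻¹' J) = J)
    (hD : D ∈ components Jᶜ) (hout : ∀ x ∈ J, ¬ adjacency x ⊆ D ∪ J) :
    slantStar (slant ⁻¹' D) ∪ mixedFill (slant ⁻¹' D) J = D := by
  have hDJ : D ⊆ Jᶜ := subset_of_mem_components hD
  refine Subset.antisymm (union_subset (fun x hx => ?_) fun x hx => ?_) fun x hx => ?_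
  · by_cases hpure : IsPure x
    · exact hpure.mem_slantStar_preimage.1 hx
    have hmixed : IsMixed x := hpure
    have hxJ : x ∉ J := fun hxJ => hout x hxJ (hmixed.adjacency_subset_of_mem_slantStar hstar
      (subset_compl_iff_disjoint_right.1 hDJ) hxJ hx)
    obtain ⟨y, hy, hxy⟩ := hmixed.exists_mem_adjacency_of_mem_slantStar hx
    exact mem_of_mem_adjacency_of_mem_components hD hy hxJ (mem_adjacency_comm.1 hxy)
  · obtain ⟨hmixed, hadj⟩ := mem_mixedFill_preimage.1 hx
    have hxJ : x ∉ J := fun hxJ => hout x hxJ hadj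
    obtain ⟨y, hxy, hyJ⟩ := hmixed.exists_mem_adjacency_notMem hstar hxJ
    exact mem_of_mem_adjacency_of_mem_components hD ((hadj hxy).resolve_right hyJ) hxJ
      (mem_adjacency_comm.1 hxy)
  · by_cases hpure : IsPure x
    · exact .inl (hpure.mem_slantStar_preimage.2 hx)
    · refine .inr (mem_mixedFill_preimage.2 ⟨hpure, fun y hxy => ?_⟩)
      by_cases hyJ : y ∈ J
      · exact .inr hyJ
      · exact .inl (mem_of_mem_adjacency_of_mem_components hD hx hyJ hxy)

end SlantStar

section FourComponents

variable {J D : Set DigitalPlane} {S T : Set (ℤ × ℤ)}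

theorem fourConnected_iff :
    FourConnected S ↔ ∀ Q : ℤ × ℤ → Prop, (∀ p ∈ S, ∀ q ∈ S, FourAdj p q → Q p → Q q) →
      ∀ p ∈ S, ∀ q ∈ S, Q p → Q q := by
  constructor
  · intro hS Q step p hp q hq hQp
    by_contra hQq
    refine hS ⟨{r ∈ S | Q r}, {r ∈ S | ¬ Q r}, ⟨p, hp, hQp⟩, ⟨q, hq, hQq⟩,
      disjoint_left.2 fun r hr hr' => hr'.2 hr.2, ?_, fun r hr s hs hrs => ?_⟩
    · ext r
      simp [← and_or_left, em]
    · exact hs.2 (step r hr.1 s hs.1 hrs hr.2)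
  · rintro h ⟨A, B, ⟨p, hp⟩, ⟨q, hq⟩, hdisj, rfl, hadj⟩
    have hqA : q ∈ A := h (· ∈ A)
      (fun r _ s hs hrs hr => hs.resolve_right fun hs => hadj r hr s hs hrs)
      p (.inl hp) q (.inr hq) hp
    exact disjoint_left.1 hdisj hqA hq

theorem preimage_slant_nonempty (hstar : slantStar (slant ⁻¹' J) = J) (hD : D ∈ components Jᶜ) :
    (slant ⁻¹' D).Nonempty := by
  obtain ⟨x, hx, rfl⟩ := id hD
  have hxD := mem_connectedComponentIn hx
  suffices ∃ y ∈ connectedComponentIn Jᶜ x, IsPure y by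
    obtain ⟨y, hy, hpure⟩ := this
    obtain ⟨p, rfl⟩ := isPure_iff_mem_range_slant.1 hpure
    exact ⟨p, hy⟩
  by_cases hpure : IsPure x
  · exact ⟨x, hxD, hpure⟩
  · obtain ⟨y, hxy, hyJ⟩ := IsMixed.exists_mem_adjacency_notMem hpure hstar hx
    exact ⟨y, mem_of_mem_adjacency_of_mem_components hD hxD hyJ hxy,
      IsMixed.isPure_of_mem_adjacency hpure hxy⟩

theorem IsMixed.adjacency_induction {x : DigitalPlane} (hx : IsMixed x)
    (hstar : slantStar (slant ⁻¹' J) = J) (hD : D ∈ components Jᶜ) (hxD : x ∈ D)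
    {Q : ℤ × ℤ → Prop}
    (step : ∀ p ∈ slant ⁻¹' D, ∀ q ∈ slant ⁻¹' D, FourAdj p q → Q p → Q q) {p q : ℤ × ℤ}
    (hp : slant p ∈ adjacency x) (hpD : slant p ∈ D) (hq : slant q ∈ adjacency x)
    (hqD : slant q ∈ D) (hQp : Q p) : Q q := by
  have hDJ : D ⊆ Jᶜ := subset_of_mem_components hD
  obtain ⟨m, ⟨hxm, hmJ⟩, hpm, hmq⟩ :=
    hx.exists_common_neighbour_notMem hstar (hDJ hxD) hp ⟨hq, hDJ hqD⟩
  have hmD : m ∈ D := mem_of_mem_adjacency_of_mem_components hD hxD hmJ hxm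
  obtain ⟨m, rfl⟩ := isPure_iff_mem_range_slant.1 (hx.isPure_of_mem_adjacency hxm)
  have hQm : Q m := by
    obtain h | h := hpm
    · rwa [slant_injective h]
    · exact step p hpD m hmD (slant_mem_adjacency_slant.1 h) hQp
  obtain h | h := hmq
  · rwa [← slant_injective h]
  · exact step m hmD q hqD (slant_mem_adjacency_slant.1 h) hQm

theorem fourConnected_preimage_slant (hstar : slantStar (slant ⁻¹' J) = J)
    (hD : D ∈ components Jᶜ) : FourConnected (slant ⁻¹' D) := by
  refine fourConnected_iff.2 fun Q step p hp q hq hQp => ?_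
  have hDconn : IsPreconnected D := by
    obtain ⟨x, -, rfl⟩ := hD
    exact isPreconnected_connectedComponentIn
  have step' : ∀ x ∈ D, ∀ y ∈ D, y ∈ adjacency x →
      (∃ r, slant r ∈ D ∧ Q r ∧ (slant r = x ∨ IsMixed x ∧ slant r ∈ adjacency x)) →
      ∃ r, slant r ∈ D ∧ Q r ∧ (slant r = y ∨ IsMixed y ∧ slant r ∈ adjacency y) := by
    rintro x hx y hy hxy ⟨r, hr, hQr, rfl | ⟨hmixed, hxr⟩⟩
    · by_cases hpure : IsPure y
      · obtain ⟨s, rfl⟩ := isPure_iff_mem_range_slant.1 hpure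
        exact ⟨s, hy, step r hr s hy (slant_mem_adjacency_slant.1 hxy) hQr, .inl rfl⟩
      · exact ⟨r, hr, hQr, .inr ⟨hpure, mem_adjacency_comm.1 hxy⟩⟩
    · obtain ⟨s, rfl⟩ := isPure_iff_mem_range_slant.1 (hmixed.isPure_of_mem_adjacency hxy)
      exact ⟨s, hy, hmixed.adjacency_induction hstar hD hx step hxr hr hxy hy hQr, .inl rfl⟩
  obtain ⟨r, -, hQr, h | ⟨hmixed, -⟩⟩ :=
    isPreconnected_induction hDconn step' hp hq ⟨p, hp, hQp, .inl rfl⟩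
  · rwa [← slant_injective h]
  · exact (hmixed (isPure_slant q)).elim

theorem FourConnected.subset_preimage_slant (hT : FourConnected T) (hTJ : T ⊆ (slant ⁻¹' J)ᶜ)
    (hD : D ∈ components Jᶜ) {p : ℤ × ℤ} (hp : p ∈ T) (hpD : slant p ∈ D) :
    T ⊆ slant ⁻¹' D := fun q hq =>
  fourConnected_iff.1 hT (slant · ∈ D)
    (fun _ _ _ hs hrs hr => mem_of_mem_adjacency_of_mem_components hD hr (hTJ hs)
      (slant_mem_adjacency_slant.2 hrs))
    p hp q hq hpD

theorem fourComponents_compl_preimage_slant (hstar : slantStar (slant ⁻¹' J) = J)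
    (hJ : Jᶜ.Nonempty) :
    fourComponents (slant ⁻¹' J)ᶜ = (slant ⁻¹' ·) '' components Jᶜ := by
  have preimage_mem : ∀ D ∈ components Jᶜ,
      slant ⁻¹' D ⊆ (slant ⁻¹' J)ᶜ ∧ FourConnected (slant ⁻¹' D) := fun D hD =>
    ⟨preimage_mono (subset_of_mem_components hD), fourConnected_preimage_slant hstar hD⟩
  ext T
  constructor
  · rintro ⟨⟨hTJ, hT⟩, hmax⟩
    have hT_nonempty : T.Nonempty := by
      obtain ⟨D, hD⟩ := hJ.image (connectedComponentIn Jᶜ)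
      by_contra! hempty
      exact (preimage_slant_nonempty hstar hD).not_subset_empty
        (hempty ▸ hmax (preimage_mem D hD) (hempty ▸ empty_subset _))
    obtain ⟨p, hp⟩ := hT_nonempty
    have hD : connectedComponentIn Jᶜ (slant p) ∈ components Jᶜ := mem_image_of_mem _ (hTJ hp)
    have hsub := hT.subset_preimage_slant hTJ hD hp (mem_connectedComponentIn (hTJ hp))
    exact ⟨_, hD, (hmax (preimage_mem _ hD) hsub).antisymm hsub⟩
  · rintro ⟨D, hD, rfl⟩
    refine ⟨preimage_mem D hD, fun T ⟨hTJ, hT⟩ hsub => ?_⟩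
    obtain ⟨p, hp⟩ := preimage_slant_nonempty hstar hD
    exact hT.subset_preimage_slant hTJ hD (hsub hp) hp

end FourComponents

end DigitalTopology

theorem mainTheorem6 (J : Set DigitalPlane)
    (hJ : DigitalTopology.IsJordanCurve J)
    (hcard : 4 < J.encard)
    (hstar : DigitalTopology.slantStar (DigitalTopology.slant ⁻¹' J) = J) :
    (DigitalTopology.components Jᶜ).encard = 2 ∧
    (∀ x ∈ J, ∀ C ∈ DigitalTopology.components Jᶜ,
      (DigitalTopology.adjacency x ∩ C).Nonempty) ∧
    ∃ A B : Set (ℤ × ℤ), A ≠ B ∧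
      DigitalTopology.fourComponents (DigitalTopology.slant ⁻¹' J)ᶜ = {A, B} ∧
      DigitalTopology.components Jᶜ =
        {DigitalTopology.slantStar A ∪ DigitalTopology.mixedFill A J,
         DigitalTopology.slantStar B ∪ DigitalTopology.mixedFill B J} := by
  have fill : ∀ D ∈ components Jᶜ,
      slantStar (slant ⁻¹' D) ∪ mixedFill (slant ⁻¹' D) J = D := fun D hD =>
    slantStar_union_mixedFill_preimage hstar hD fun _ hx => hJ.not_adjacency_subset_union hx hD
  refine ⟨hJ.encard_components_compl, fun x hx C hC => hJ.adjacency_inter_nonempty hx hC, ?_⟩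
  obtain ⟨D, E, hDE, hcomp⟩ := encard_eq_two.1 hJ.encard_components_compl
  have fillD := fill D (by simp [hcomp])
  have fillE := fill E (by simp [hcomp])
  have hcompl : Jᶜ.Nonempty := image_nonempty.1 (hcomp ▸ insert_nonempty D {E})
  refine ⟨slant ⁻¹' D, slant ⁻¹' E, fun hAB => ?_, ?_, ?_⟩
  · exact hDE (by rw [← fillD, hAB, fillE])
  · rw [fourComponents_compl_preimage_slant hstar hcompl, hcomp, image_pair]
  · rw [fillD, fillE, hcomp]
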